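/- Let $X$ be a complex Banach space. A *spectral measure* on $X$ is a map $E$ assigning to each Borel set $\delta\subseteq\mathbb C$ a bounded projection $E(\delta)$ on $X$ such that $E(\emptyset)=0$, $E(\mathbb C)=I$, $E(\delta\cap\sigma)=E(\delta)E(\sigma)$ for all Borel $\delta,\sigma$, and $E$ is strongly $\sigma$-additive. For a closed linear operator $A$ in $X$ with domain $D(A)$, the spectrum $\sigma(A)$ is the set of all $\lambda\in\mathbb C$ for which $A-\lambda I:D(A)\to X$ is not bijective. A (possibly unbounded) densely defined closed linear operator $A$ in $X$ is a *scalar type spectral operator* if there is a spectral measure $E$ on $X$ such that 1. $E(\delta)X\subseteq D(A)$ for each bounded Borel set $\delta$; 2. $E(\delta)D(A)\subseteq D(A)$ and $AE(\delta)f=E(\delta)Af$ for all Borel sets $\delta$ and all $f\in D(A)$; 3. $\sigma(A|_{E(\delta)X})\subseteq\overline{\delta}$ for each Borel set $\delta$, where $A|_{E(\delta)X}$ is the restriction of $A$ to $D(A)\cap E(\delta)X$, regarded as an operator in $E(\delta)X$; 4. $A=\int_{\mathbb C}\lambda\,dE(\lambda)$, that is, with $A_n=\int_{\{|\lambda|\le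 n\}}\lambda\,dE(\lambda)$ (the operator norm limit of the integrals of Borel simple functions converging uniformly to $\lambda\chi_{\{|\lambda|\le n\}}$), $D(A)=\{f\in X : \lim_{n\to\infty}A_nf\text{ exists}\}$ and $Af=\lim_{n\to\infty}A_nf$ for $f\in D(A)$. **Theorem (characterization of spectral gap at $0$).** Let $A$ be a scalar type spectral operator in a complex Banach space $X$ with $0\in\sigma(A)$. Then $0$ is an isolated point of $\sigma(A)$ if and only if the range $R(A)=\{Af : f\in D(A)\}$ is closed in $X$. -/

import Mathlib

open Filter Topology MeasureTheory

namespace ScalarSpectral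

noncomputable section

variable {X : Type*} [NormedAddCommGroup X] [NormedSpace ℂ X]

/-- The spectrum of a (closed, possibly unbounded) linear operator `A` in `X` with domain
`D(A) = A.domain`: the set of all `z` for which `A - z I : D(A) → X` is not bijective, i.e. is
either not one-to-one, or one-to-one with range different from `X`.  (For a closed operator in a
Banach space the inverse of a bijective `A - z I` is automatically bounded.) -/
def opSpectrum (A : X →ₗ.[ℂ] X) : Set ℂ :=
  {z | ¬ Function.Bijective (fun x : A.domain => A x - z • (x : X))}

/-- The range `R(A)` of a linear operator in `X`. -/
def opRange (A : X →ₗ.[ℂ] X) : Set X := Set.range (fun x : A.domain => A x)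

/-- The restriction of `A` to a subspace `Y`, as an operator in `Y`, with domain
`{y ∈ D(A) ∩ Y | A y ∈ Y}`.  When `A` maps `D(A) ∩ Y` into `Y`, which is the case for
`Y = E(δ) X` with `E` commuting with `A`, this domain is just `D(A) ∩ Y`. -/
def opRestrict (A : X →ₗ.[ℂ] X) (Y : Submodule ℂ X) : Y →ₗ.[ℂ] Y where
  domain :=
    { carrier := {y | ∃ h : (y : X) ∈ A.domain, A ⟨(y : X), h⟩ ∈ Y}
      zero_mem' := ⟨A.domain.zero_mem, by
        have h : A (0 : A.domain) ∈ Y := by rw [LinearPMap.map_zero]; exact Y.zero_mem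
        exact h⟩
      add_mem' := by
        rintro a b ⟨ha, ha'⟩ ⟨hb, hb'⟩
        refine ⟨A.domain.add_mem ha hb, ?_⟩
        have h : A (⟨(a : X), ha⟩ + ⟨(b : X), hb⟩ : A.domain) ∈ Y := by
          rw [LinearPMap.map_add]; exact Y.add_mem ha' hb'
        exact h
      smul_mem' := by
        rintro c a ⟨ha, ha'⟩
        refine ⟨A.domain.smul_mem c ha, ?_⟩
        have h : A (c • ⟨(a : X), ha⟩ : A.domain) ∈ Y := by
          rw [LinearPMap.map_smul]; exact Y.smul_mem c ha'
        exact h }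
  toFun :=
    { toFun := fun y => ⟨A ⟨((y : Y) : X), y.2.1⟩, y.2.2⟩
      map_add' := fun a b =>
        Subtype.ext (LinearPMap.map_add A ⟨((a : Y) : X), a.2.1⟩ ⟨((b : Y) : X), b.2.1⟩)
      map_smul' := fun c a =>
        Subtype.ext (LinearPMap.map_smul A c ⟨((a : Y) : X), a.2.1⟩) }

/-- A spectral measure (resolution of the identity) on the Borel sets of `ℂ`: a strongly
`σ`-additive, multiplicative function with values in the bounded projections on `X`.
The values on sets that are not Borel are irrelevant. -/
structure SpectralMeasure (X : Type*) [NormedAddCommGroup X] [NormedSpace ℂ X] where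
  /-- the projection `E(δ)` -/
  proj : Set ℂ → (X →L[ℂ] X)
  proj_empty : proj ∅ = 0
  proj_univ : proj Set.univ = ContinuousLinearMap.id ℂ X
  /-- multiplicativity; for `δ = σ` it says that `E(δ)` is a projection -/
  proj_inter : ∀ δ σ : Set ℂ, MeasurableSet δ → MeasurableSet σ →
    proj (δ ∩ σ) = (proj δ).comp (proj σ)
  hasSum_proj_iUnion : ∀ δ : ℕ → Set ℂ, (∀ n, MeasurableSet (δ n)) →
    Pairwise (fun m n => Disjoint (δ m) (δ n)) →
    ∀ x : X, HasSum (fun n => proj (δ n) x) (proj (⋃ n, δ n) x)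

/-- `A` is a spectral operator with spectral measure `E`. -/
structure IsSpectralOperator (A : X →ₗ.[ℂ] X) (E : SpectralMeasure X) : Prop where
  dense_domain : Dense (A.domain : Set X)
  closed : A.IsClosed
  mem_domain_of_isBounded : ∀ δ : Set ℂ, MeasurableSet δ → Bornology.IsBounded δ →
    ∀ x : X, E.proj δ x ∈ A.domain
  commute : ∀ δ : Set ℂ, MeasurableSet δ → ∀ x : A.domain,
    ∃ h : E.proj δ (x : X) ∈ A.domain, A ⟨E.proj δ (x : X), h⟩ = E.proj δ (A x)
  spectrum_restrict : ∀ δ : Set ℂ, MeasurableSet δ →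
    opSpectrum (opRestrict A (LinearMap.range (E.proj δ : X →ₗ[ℂ] X))) ⊆ closure δ

/-- The integral `∑ c E({s = c})` of a Borel simple function `s`. -/
def simpleIntegral (E : SpectralMeasure X) (s : SimpleFunc ℂ ℂ) : X →L[ℂ] X :=
  ∑ c ∈ s.range, c • E.proj (s ⁻¹' {c})

/-- `T = ∫ F dE` for a bounded Borel function `F`: `T` is the limit, in the operator norm, of the
integrals of a sequence of Borel simple functions that converges to `F` uniformly on `ℂ`. -/
def HasBoundedIntegral (E : SpectralMeasure X) (F : ℂ → ℂ) (T : X →L[ℂ] X) : Prop :=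
  ∃ s : ℕ → SimpleFunc ℂ ℂ, TendstoUniformly (fun n z => s n z) F atTop ∧
    Tendsto (fun n => simpleIntegral E (s n)) atTop (𝓝 T)

open Classical in
/-- The bounded operator `∫ F dE` for a bounded Borel function `F`. -/
def boundedIntegral (E : SpectralMeasure X) (F : ℂ → ℂ) : X →L[ℂ] X :=
  if h : ∃ T, HasBoundedIntegral E F T then h.choose else 0

/-- The truncation `F_n = F χ_{|F| ≤ n}`. -/
def truncation (F : ℂ → ℂ) (n : ℕ) : ℂ → ℂ := Set.indicator {z | ‖F z‖ ≤ n} F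

/-- The (in general unbounded) operator `∫ F dE` for a Borel function `F`: its domain consists of
all `x` for which the limit of `(∫ F_n dE) x` exists, and its value at `x` is that limit. -/
def spectralIntegral (E : SpectralMeasure X) (F : ℂ → ℂ) : X →ₗ.[ℂ] X where
  domain :=
    { carrier := {x | ∃ y, Tendsto (fun n => boundedIntegral E (truncation F n) x) atTop (𝓝 y)}
      zero_mem' := ⟨0, by simp⟩
      add_mem' := by
        rintro a b ⟨y, hy⟩ ⟨z, hz⟩
        exact ⟨y + z, by simpa using hy.add hz⟩
      smul_mem' := by
        rintro c a ⟨y, hy⟩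
        exact ⟨c • y, by simpa using hy.const_smul c⟩ }
  toFun :=
    { toFun := fun x => x.2.choose
      map_add' := fun a b => tendsto_nhds_unique (a + b).2.choose_spec
        (by simpa using a.2.choose_spec.add b.2.choose_spec)
      map_smul' := fun c a => tendsto_nhds_unique (c • a).2.choose_spec
        (by simpa using a.2.choose_spec.const_smul c) }

/-- `A` is a scalar type spectral operator: it is a spectral operator with some spectral measure
`E`, and `A = ∫ z dE(z)` (equality of operators, including their domains). -/
def IsScalarType (A : X →ₗ.[ℂ] X) : Prop :=
  ∃ E : SpectralMeasure X, IsSpectralOperator A E ∧ A = spectralIntegral E (fun z => z)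

end

end ScalarSpectral

namespace ScalarSpectral

variable {X : Type*} [NormedAddCommGroup X] [NormedSpace ℂ X]

/-! ### Spectral measures and integrals on atoms -/

namespace SpectralMeasure

variable (E : SpectralMeasure X)

/-! The scalar type hypothesis enters only through `A E({0}) = 0`, the hypothesis `hker` below; all
else holds for spectral operators. Both directions pass through the vanishing of `E` on a punctured
disc around `0`.

If `0` is isolated, `E` vanishes on such a disc, since a bounded operator on a nonzero space has
nonempty spectrum (`proj_eq_zero_of_disjoint`). Hence `X` is the direct sum of `E({0})X`, killed by
`A`, and `E({|z| ≥ r})X`, which `A` maps onto itself, so `R(A) = ker E({0})` is closed.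

If `R(A)` is closed, the open mapping theorem gives `‖Ax‖ ≥ c‖x‖` on `ker E({0})`
(`exists_bounded_below`). On `E({0 < |z| < c/2})X` the spectral radius of `A` is at most `c/2`,
while the powers of `A` grow at least like `c ^ n`; Gelfand's formula forces this space to be zero
(`proj_eq_zero_of_bounded_below`). Then `A - z` with `0 < |z| < c/2` is invertible on both summands.
-/

theorem proj_apply_proj {δ σ : Set ℂ} (hδ : MeasurableSet δ) (hσ : MeasurableSet σ) (x : X) :
    E.proj δ (E.proj σ x) = E.proj (δ ∩ σ) x := by
  rw [E.proj_inter δ σ hδ hσ]; rfl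

theorem proj_proj_self {δ : Set ℂ} (hδ : MeasurableSet δ) (x : X) :
    E.proj δ (E.proj δ x) = E.proj δ x := by
  rw [E.proj_apply_proj hδ hδ, Set.inter_self]

theorem mem_range_proj_iff {δ : Set ℂ} (hδ : MeasurableSet δ) {x : X} :
    x ∈ LinearMap.range (E.proj δ : X →ₗ[ℂ] X) ↔ E.proj δ x = x := by
  constructor
  · rintro ⟨y, rfl⟩
    exact E.proj_proj_self hδ y
  · intro h
    exact ⟨x, h⟩

theorem isClosed_range_proj {δ : Set ℂ} (hδ : MeasurableSet δ) :
    IsClosed (LinearMap.range (E.proj δ : X →ₗ[ℂ] X) : Set X) := by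
  have h : (LinearMap.range (E.proj δ : X →ₗ[ℂ] X) : Set X) = {x | E.proj δ x = x} :=
    Set.ext fun x => E.mem_range_proj_iff hδ
  rw [h]
  exact isClosed_eq (E.proj δ).continuous continuous_id

theorem proj_iUnion_eq_zero {δ : ℕ → Set ℂ} (hδ : ∀ n, MeasurableSet (δ n))
    (hd : Pairwise (fun m n => Disjoint (δ m) (δ n))) {x : X}
    (h : ∀ n, E.proj (δ n) x = 0) : E.proj (⋃ n, δ n) x = 0 := by
  have hs := E.hasSum_proj_iUnion δ hδ hd x
  simp only [h] at hs
  exact hs.unique hasSum_zero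

theorem proj_union {δ σ : Set ℂ} (hδ : MeasurableSet δ) (hσ : MeasurableSet σ)
    (hd : Disjoint δ σ) (x : X) : E.proj (δ ∪ σ) x = E.proj δ x + E.proj σ x := by
  -- Finite additivity is countable additivity for a sequence padded with `∅`.
  let f : ℕ → Set ℂ := fun n => if n = 0 then δ else if n = 1 then σ else ∅
  have hU : ⋃ n, f n = δ ∪ σ := by
    ext z
    simp only [Set.mem_iUnion, Set.mem_union]
    constructor
    · rintro ⟨n, hn⟩
      by_cases h0 : n = 0
      · exact Or.inl (by simpa [f, h0] using hn)
      · by_cases h1 : n = 1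
        · exact Or.inr (by simpa [f, h1] using hn)
        · simp [f, h0, h1] at hn
    · rintro (h | h)
      · exact ⟨0, by simpa [f] using h⟩
      · exact ⟨1, by simpa [f] using h⟩
  have hs := E.hasSum_proj_iUnion f
    (fun n => by
      by_cases h0 : n = 0
      · simpa [f, h0] using hδ
      · by_cases h1 : n = 1
        · simpa [f, h1] using hσ
        · simp [f, h0, h1])
    (fun m n hmn => by
      by_cases h0 : m = 0 <;> by_cases h1 : m = 1 <;> by_cases h2 : n = 0 <;>
        by_cases h3 : n = 1 <;> simp_all [f, hd.symm]) x
  rw [hU] at hs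
  refine hs.unique ?_
  have := hasSum_sum_of_ne_finset_zero (L := .unconditional ℕ) (f := fun n => E.proj (f n) x) (s := Finset.range 2)
    (fun n hn => by
      have h0 : n ≠ 0 := fun h => hn (by simp [h])
      have h1 : n ≠ 1 := fun h => hn (by simp [h])
      simp [f, h0, h1, E.proj_empty])
  simpa [Finset.sum_range_succ, f] using this

theorem proj_add_compl {δ : Set ℂ} (hδ : MeasurableSet δ) (x : X) :
    E.proj δ x + E.proj δᶜ x = x := by
  rw [← E.proj_union hδ hδ.compl disjoint_compl_right, Set.union_compl_self, E.proj_univ]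
  rfl

/-- A vector annihilated by `E` on the Borel subsets of `S` whose closure misses `0` is annihilated
on `S \ {0}`. -/
theorem proj_diff_zero_eq_zero {S : Set ℂ} (hS : MeasurableSet S) {x : X}
    (h : ∀ δ : Set ℂ, MeasurableSet δ → δ ⊆ S → (0 : ℂ) ∉ closure δ → E.proj δ x = 0) :
    E.proj (S \ {0}) x = 0 := by
  -- Shells `1/(n+1) < |z| ≤ 1/n` (`|z| > 1` for `n = 0`), each at positive distance from `0`.
  let δ : ℕ → Set ℂ := fun n => (S \ {0}) ∩ {z | ⌊‖z‖⁻¹⌋₊ = n}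
  have hδ : ∀ n, MeasurableSet (δ n) := fun n =>
    (hS.diff (measurableSet_singleton 0)).inter
      ((Nat.measurable_floor.comp measurable_norm.inv) (measurableSet_singleton n))
  have hd : Pairwise (fun m n => Disjoint (δ m) (δ n)) := by
    intro m n hmn
    refine Set.disjoint_left.2 fun z hz hz' => hmn ?_
    exact hz.2.symm.trans hz'.2
  have hU : ⋃ n, δ n = S \ {0} := by
    ext z
    simp [δ]
  rw [← hU]
  refine E.proj_iUnion_eq_zero hδ hd fun n => h _ (hδ n) (fun z hz => hz.1.1) ?_
  intro h0
  have hsub : δ n ⊆ {z | ((n : ℝ) + 1)⁻¹ ≤ ‖z‖} := by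
    rintro z ⟨⟨-, hz0⟩, hzn⟩
    have hz : 0 < ‖z‖ := norm_pos_iff.2 hz0
    have h1 : ‖z‖⁻¹ < n + 1 := by
      have := Nat.lt_floor_add_one ‖z‖⁻¹
      rwa [show ⌊‖z‖⁻¹⌋₊ = n from hzn] at this
    exact inv_le_of_inv_le₀ hz h1.le
  have h2 := closure_minimal hsub (isClosed_le continuous_const continuous_norm) h0
  have h3 : (0 : ℝ) < ((n : ℝ) + 1)⁻¹ := by positivity
  simp only [Set.mem_ofPred_eq, norm_zero] at h2
  linarith

/-- Among the fibres of `s` only the one over `s z` meets `{z}`. -/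
theorem simpleIntegral_proj_singleton (s : SimpleFunc ℂ ℂ) (z : ℂ) (x : X) :
    simpleIntegral E s (E.proj {z} x) = s z • E.proj {z} x := by
  classical
  have hterm : ∀ c ∈ s.range, (c • E.proj (s ⁻¹' {c})) (E.proj {z} x)
      = if c = s z then s z • E.proj {z} x else 0 := by
    intro c _
    rw [smul_apply,
      E.proj_apply_proj (s.measurableSet_fiber c) (measurableSet_singleton z)]
    split_ifs with hc
    · rw [Set.inter_eq_right.2 (by simp [hc]), hc]
    · have : s ⁻¹' {c} ∩ {z} = ∅ := by
        ext w
        simp only [Set.mem_inter_iff, Set.mem_preimage, Set.mem_singleton_iff,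
          Set.mem_empty_iff_false, iff_false, not_and]
        rintro rfl rfl
        exact hc rfl
      simp [this, E.proj_empty]
  rw [simpleIntegral, sum_apply, Finset.sum_congr rfl hterm,
    Finset.sum_ite_eq' s.range (s z), if_pos (s.mem_range_self z)]

/-- Uniform convergence gives the value `F z` on the atom. If no integral exists, the default `0`
gives the same conclusion, so existence never has to be proved. -/
theorem boundedIntegral_proj_singleton {F : ℂ → ℂ} {z : ℂ} (hF : F z = 0) (x : X) :
    boundedIntegral E F (E.proj {z} x) = 0 := by
  unfold boundedIntegral
  split_ifs with h
  · obtain ⟨s, hs, hT⟩ := h.choose_spec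
    have h1 : Tendsto (fun n => simpleIntegral E (s n) (E.proj {z} x)) atTop
        (𝓝 (h.choose (E.proj {z} x))) :=
      ((ContinuousLinearMap.apply ℂ X (E.proj {z} x)).continuous.tendsto _).comp hT
    have h2 : Tendsto (fun n => s n z • E.proj {z} x) atTop (𝓝 (F z • E.proj {z} x)) :=
      (hs.tendsto_at z).smul_const _
    simp only [E.simpleIntegral_proj_singleton] at h1
    rw [tendsto_nhds_unique h1 h2, hF, zero_smul]
  · rfl

theorem spectralIntegral_proj_singleton {F : ℂ → ℂ} {z : ℂ} (hF : F z = 0) (x : X) :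
    ∃ h : E.proj {z} x ∈ (spectralIntegral E F).domain,
      spectralIntegral E F ⟨E.proj {z} x, h⟩ = 0 := by
  have h0 : ∀ n : ℕ, boundedIntegral E (truncation F n) (E.proj {z} x) = 0 := fun n =>
    E.boundedIntegral_proj_singleton (by simp [truncation, hF]) x
  have ht : Tendsto (fun n : ℕ => boundedIntegral E (truncation F n) (E.proj {z} x)) atTop
      (𝓝 0) := by
    simp only [h0]
    exact tendsto_const_nhds
  have h : E.proj {z} x ∈ (spectralIntegral E F).domain := ⟨0, ht⟩
  exact ⟨h, tendsto_nhds_unique h.choose_spec ht⟩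

end SpectralMeasure

theorem apply_eq_of_eq {A : X →ₗ.[ℂ] X} {x y : A.domain} (h : (x : X) = y) : A x = A y :=
  congrArg A (Subtype.ext h)

/-! ### Restrictions of a spectral operator to ranges of `E` -/

namespace IsSpectralOperator

variable {A : X →ₗ.[ℂ] X} {E : SpectralMeasure X}

theorem proj_apply_of_proj_eq (hA : IsSpectralOperator A E) {δ : Set ℂ} (hδ : MeasurableSet δ)
    (x : A.domain) (hx : E.proj δ (x : X) = x) : E.proj δ (A x) = A x := by
  obtain ⟨h, h'⟩ := hA.commute δ hδ x
  rw [← h']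
  exact apply_eq_of_eq hx

/-- For `z` outside `closure δ`, `A - z` is injective on `E(δ) X`. -/
theorem eq_zero_of_apply_eq_smul (hA : IsSpectralOperator A E) {δ : Set ℂ}
    (hδ : MeasurableSet δ) {z : ℂ} (hz : z ∉ closure δ) (x : A.domain)
    (hx : E.proj δ (x : X) = x) (hAx : A x = z • (x : X)) : (x : X) = 0 := by
  have hb := not_not.1 fun h => hz (hA.spectrum_restrict δ hδ h)
  let Y := LinearMap.range (E.proj δ : X →ₗ[ℂ] X)
  have hxY : (x : X) ∈ Y := (E.mem_range_proj_iff hδ).2 hx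
  have hAY : A x ∈ Y := by rw [hAx]; exact Y.smul_mem z hxY
  let u : (opRestrict A Y).domain := ⟨⟨x, hxY⟩, ⟨x.2, hAY⟩⟩
  have hu : u = 0 := by
    apply hb.1
    refine Subtype.ext ?_
    have h1 : A x - z • (x : X) = 0 := by rw [hAx, sub_self]
    have h2 : (opRestrict A Y) 0 - z • ((0 : (opRestrict A Y).domain) : Y) = 0 := by
      rw [LinearPMap.map_zero]; simp
    exact h1.trans (congrArg Subtype.val h2).symm
  exact congrArg (fun v : (opRestrict A Y).domain => ((v : Y) : X)) hu

/-- For `z` outside `closure δ`, `A - z` maps `D(A) ∩ E(δ) X` onto `E(δ) X`. -/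
theorem exists_apply_sub_smul_eq (hA : IsSpectralOperator A E) {δ : Set ℂ}
    (hδ : MeasurableSet δ) {z : ℂ} (hz : z ∉ closure δ) {y : X} (hy : E.proj δ y = y) :
    ∃ x : A.domain, E.proj δ (x : X) = x ∧ A x - z • (x : X) = y := by
  have hb := not_not.1 fun h => hz (hA.spectrum_restrict δ hδ h)
  obtain ⟨x, hx⟩ := hb.2 ⟨y, (E.mem_range_proj_iff hδ).2 hy⟩
  exact ⟨⟨x, x.2.1⟩, (E.mem_range_proj_iff hδ).1 x.1.2, congrArg Subtype.val hx⟩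

/-- Since `E(δ)` commutes with `A`, it sends a preimage of `y ∈ E(δ)X` under `A - z` to a preimage
inside `E(δ)X`. -/
theorem opSpectrum_opRestrict_subset (hA : IsSpectralOperator A E) {δ : Set ℂ}
    (hδ : MeasurableSet δ) :
    opSpectrum (opRestrict A (LinearMap.range (E.proj δ : X →ₗ[ℂ] X))) ⊆ opSpectrum A := by
  intro z hz hb
  refine hz ⟨fun u v huv => ?_, fun y => ?_⟩
  · have h : (⟨u, u.2.1⟩ : A.domain) = ⟨v, v.2.1⟩ := hb.1 (congrArg Subtype.val huv)
    exact Subtype.ext (Subtype.ext (congrArg (fun w : A.domain => (w : X)) h))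
  · obtain ⟨x, hx⟩ := hb.2 (y : X)
    obtain ⟨h, h'⟩ := hA.commute δ hδ x
    have hy := (E.mem_range_proj_iff hδ).1 y.2
    have hAE : A ⟨E.proj δ x, h⟩ - z • E.proj δ (x : X) = y := by
      rw [h', ← map_smul, ← map_sub]
      exact (congrArg (E.proj δ) hx).trans hy
    exact ⟨⟨⟨E.proj δ x, ⟨x, rfl⟩⟩, ⟨h, ⟨A x, h'.symm⟩⟩⟩, Subtype.ext hAE⟩

/-- On the range of `E(δ)`, `δ` bounded, `A` acts as a bounded operator whose spectrum is contained
in that of the restriction of `A`. -/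
theorem exists_bounded_restrict [CompleteSpace X] (hA : IsSpectralOperator A E) {δ : Set ℂ}
    (hδ : MeasurableSet δ) (hb : Bornology.IsBounded δ) :
    ∃ B : LinearMap.range (E.proj δ : X →ₗ[ℂ] X) →L[ℂ] LinearMap.range (E.proj δ : X →ₗ[ℂ] X),
      (∀ y : LinearMap.range (E.proj δ : X →ₗ[ℂ] X),
        ∃ h : (y : X) ∈ A.domain, (B y : X) = A ⟨y, h⟩) ∧
      spectrum ℂ B ⊆ opSpectrum (opRestrict A (LinearMap.range (E.proj δ : X →ₗ[ℂ] X))) := by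
  let Y := LinearMap.range (E.proj δ : X →ₗ[ℂ] X)
  have : CompleteSpace Y := (E.isClosed_range_proj hδ).completeSpace_coe
  have hdom : ∀ y : Y, (y : X) ∈ A.domain := by
    intro y
    rw [← (E.mem_range_proj_iff hδ).1 y.2]
    exact hA.mem_domain_of_isBounded δ hδ hb _
  have hAY : ∀ y : Y, A ⟨y, hdom y⟩ ∈ Y := fun y =>
    (E.mem_range_proj_iff hδ).2
      (hA.proj_apply_of_proj_eq hδ ⟨y, hdom y⟩ ((E.mem_range_proj_iff hδ).1 y.2))
  let T : Y →ₗ[ℂ] Y :=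
    { toFun := fun y => ⟨A ⟨y, hdom y⟩, hAY y⟩
      map_add' := fun a b =>
        Subtype.ext (LinearPMap.map_add A ⟨(a : X), hdom a⟩ ⟨(b : X), hdom b⟩)
      map_smul' := fun c a => Subtype.ext (LinearPMap.map_smul A c ⟨(a : X), hdom a⟩) }
  -- Boundedness comes from the closed graph theorem: the graph of `T` is the trace of that of `A`
  -- on `Y × Y`.
  have hg : IsClosed (T.graph : Set (Y × Y)) := by
    have h : (T.graph : Set (Y × Y)) =
        (fun p : Y × Y => ((p.1 : X), (p.2 : X))) ⁻¹' (A.graph : Set (X × X)) := by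
      ext p
      simp only [SetLike.mem_coe, LinearMap.mem_graph_iff, Set.mem_preimage,
        LinearPMap.mem_graph_iff]
      constructor
      · intro hp
        exact ⟨⟨p.1, hdom p.1⟩, rfl, by rw [hp]; rfl⟩
      · rintro ⟨x, hx, hAx⟩
        refine Subtype.ext (hAx.symm.trans ?_)
        exact apply_eq_of_eq hx
    rw [h]
    exact IsClosed.preimage (by fun_prop) hA.closed
  let B : Y →L[ℂ] Y := ⟨T, T.continuous_of_isClosed_graph hg⟩
  refine ⟨B, fun y => ⟨hdom y, rfl⟩, fun z hz hbij => hz ?_⟩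
  rw [spectrum.mem_resolventSet_iff, ← IsUnit.neg_iff, ContinuousLinearMap.isUnit_iff_bijective]
  have hval : ∀ y : Y, (-(algebraMap ℂ (Y →L[ℂ] Y) z - B)) y = B y - z • y := by
    intro y
    simp [Algebra.algebraMap_eq_smul_one]
  refine ⟨fun u v huv => ?_, fun y => ?_⟩
  · rw [hval, hval] at huv
    have h : (⟨u, ⟨hdom u, hAY u⟩⟩ : (opRestrict A Y).domain) = ⟨v, ⟨hdom v, hAY v⟩⟩ :=
      hbij.1 huv
    exact congrArg Subtype.val h
  · obtain ⟨x, hx⟩ := hbij.2 y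
    exact ⟨x, (hval x).trans hx⟩

/-- `E` vanishes on bounded Borel sets whose closure misses the spectrum of `A`. -/
theorem proj_eq_zero_of_disjoint [CompleteSpace X] (hA : IsSpectralOperator A E) {δ : Set ℂ}
    (hδ : MeasurableSet δ) (hb : Bornology.IsBounded δ)
    (hd : Disjoint (closure δ) (opSpectrum A)) (x : X) : E.proj δ x = 0 := by
  obtain ⟨B, -, hB⟩ := hA.exists_bounded_restrict hδ hb
  by_contra hx
  have : CompleteSpace (LinearMap.range (E.proj δ : X →ₗ[ℂ] X)) :=
    (E.isClosed_range_proj hδ).completeSpace_coe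
  have : Nontrivial (LinearMap.range (E.proj δ : X →ₗ[ℂ] X)) :=
    ⟨⟨E.proj δ x, ⟨x, rfl⟩⟩, 0, fun h => hx (congrArg Subtype.val h)⟩
  obtain ⟨z, hz⟩ := spectrum.nonempty B
  exact Set.disjoint_left.1 hd (hA.spectrum_restrict δ hδ (hB hz))
    (hA.opSpectrum_opRestrict_subset hδ (hB hz))

/-- If `δ` lies in a ball of radius less than `c` and `A` is bounded below by `c` on `E(δ) X`,
then `E(δ) = 0`. -/
theorem proj_eq_zero_of_bounded_below [CompleteSpace X] (hA : IsSpectralOperator A E)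
    {δ : Set ℂ} (hδ : MeasurableSet δ) {ε c : ℝ} (hε : 0 ≤ ε) (hεc : ε < c)
    (hsub : δ ⊆ Metric.closedBall 0 ε)
    (hc : ∀ x : A.domain, E.proj δ (x : X) = x → c * ‖(x : X)‖ ≤ ‖A x‖) (x : X) :
    E.proj δ x = 0 := by
  let Y := LinearMap.range (E.proj δ : X →ₗ[ℂ] X)
  obtain ⟨(B : Y →L[ℂ] Y), hBA, hB⟩ :=
    hA.exists_bounded_restrict hδ (Metric.isBounded_closedBall.subset hsub)
  have : CompleteSpace Y := (E.isClosed_range_proj hδ).completeSpace_coe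
  have hc0 : 0 < c := hε.trans_lt hεc
  have hBc : ∀ y : Y, c * ‖y‖ ≤ ‖B y‖ := by
    intro y
    obtain ⟨h, h'⟩ := hBA y
    have := hc ⟨y, h⟩ ((E.mem_range_proj_iff hδ).1 y.2)
    rwa [← h'] at this
  have hpow : ∀ (n : ℕ) (y : Y), c ^ n * ‖y‖ ≤ ‖(B ^ n) y‖ := by
    intro n
    induction n with
    | zero => intro y; simp
    | succ n ih =>
      intro y
      calc c ^ (n + 1) * ‖y‖ = c ^ n * (c * ‖y‖) := by ring
        _ ≤ c ^ n * ‖B y‖ := by gcongr; exact hBc y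
        _ ≤ ‖(B ^ n) (B y)‖ := ih (B y)
        _ = ‖(B ^ (n + 1)) y‖ := by rw [pow_succ]; rfl
  have hrad : spectralRadius ℂ B ≤ ENNReal.ofReal ε := by
    refine iSup₂_le fun z hz => ?_
    have h1 : z ∈ closure δ := hA.spectrum_restrict δ hδ (hB hz)
    have h2 := closure_minimal hsub Metric.isClosed_closedBall h1
    rw [mem_closedBall_zero_iff] at h2
    rw [← enorm_eq_nnnorm, ← ofReal_norm]
    exact ENNReal.ofReal_le_ofReal h2
  have hlim := spectrum.pow_norm_pow_one_div_tendsto_nhds_spectralRadius B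
  have hlt : spectralRadius ℂ B < ENNReal.ofReal c :=
    hrad.trans_lt ((ENNReal.ofReal_lt_ofReal_iff hc0).2 hεc)
  obtain ⟨n, hn, hn0⟩ := ((hlim.eventually_lt_const hlt).and (eventually_gt_atTop 0)).exists
  have hn1 : ‖B ^ n‖ ^ (1 / n : ℝ) < c := (ENNReal.ofReal_lt_ofReal_iff hc0).1 hn
  have hn2 : ‖B ^ n‖ < c ^ n := by
    by_contra! hle
    -- Gelfand's formula yields an `n > 0` with `‖B ^ n‖ < c ^ n`, which contradicts `hpow` on any
    -- nonzero vector.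
    have h3 : (c ^ n) ^ (1 / n : ℝ) ≤ ‖B ^ n‖ ^ (1 / n : ℝ) :=
      Real.rpow_le_rpow (by positivity) hle (by positivity)
    rw [one_div, Real.pow_rpow_inv_natCast hc0.le hn0.ne', ← one_div] at h3
    linarith
  by_contra hx
  have hpos : 0 < ‖(⟨E.proj δ x, ⟨x, rfl⟩⟩ : Y)‖ := norm_pos_iff.2 fun h =>
    hx (congrArg Subtype.val h)
  have h4 := (hpow n ⟨E.proj δ x, ⟨x, rfl⟩⟩).trans ((B ^ n).le_opNorm _)
  exact absurd (le_of_mul_le_mul_right h4 hpos) (not_le.2 hn2)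

/-- An operator with closed range that is injective on the kernel of `E({0})`, and vanishes on the
range of `E({0})`, is bounded below on the former. -/
theorem exists_bounded_below [CompleteSpace X] (hA : IsSpectralOperator A E)
    (hker : ∀ x : X, ∃ h : E.proj {0} x ∈ A.domain, A ⟨E.proj {0} x, h⟩ = 0)
    (hinj : ∀ x : A.domain, E.proj {0} (x : X) = 0 → A x = 0 → (x : X) = 0)
    (hcl : IsClosed (opRange A)) :
    ∃ c : ℝ, 0 < c ∧ ∀ x : A.domain, E.proj {0} (x : X) = 0 → c * ‖(x : X)‖ ≤ ‖A x‖ := by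
  -- The part of the graph over `ker E({0})` is a Banach space on which `A` becomes the bounded map
  -- `f`, the second projection.
  let G : Submodule ℂ (X × X) :=
    A.graph ⊓ LinearMap.ker ((E.proj {0}).comp (ContinuousLinearMap.fst ℂ X X) : X × X →ₗ[ℂ] X)
  have hG : IsClosed (G : Set (X × X)) :=
    IsClosed.inter hA.closed ((E.proj {0}).comp (ContinuousLinearMap.fst ℂ X X)).isClosed_ker
  have : CompleteSpace G := hG.completeSpace_coe
  let f : G →L[ℂ] X := (ContinuousLinearMap.snd ℂ X X).comp G.subtypeL
  have hmem : ∀ x : A.domain, E.proj {0} (x : X) = 0 → ((x : X), A x) ∈ G := fun x hx =>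
    ⟨A.mem_graph x, hx⟩
  have hfinj : Function.Injective f := by
    refine (injective_iff_map_eq_zero f).2 fun p hp => ?_
    obtain ⟨x, hx1, hx2⟩ := (LinearPMap.mem_graph_iff _).1 p.2.1
    have hp' : (p : X × X).2 = 0 := hp
    have h1 : E.proj {0} (p : X × X).1 = 0 := p.2.2
    have h2 := hinj x (by rw [hx1]; exact h1) (by rw [hx2]; exact hp')
    exact Subtype.ext (Prod.ext (hx1.symm.trans h2) hp')
  have hrange : Set.range f = opRange A := by
    ext y
    constructor
    · rintro ⟨p, rfl⟩
      obtain ⟨x, -, hx2⟩ := (LinearPMap.mem_graph_iff _).1 p.2.1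
      exact ⟨x, hx2⟩
    · rintro ⟨x, rfl⟩
      obtain ⟨h, h'⟩ := hker x
      -- Removing the `E({0})` component does not change `A x`, so the restriction to `ker E({0})`
      -- keeps the whole range.
      let u : A.domain := x - ⟨E.proj {0} (x : X), h⟩
      have hu : E.proj {0} (u : X) = 0 := by
        change E.proj {0} ((x : X) - E.proj {0} (x : X)) = 0
        rw [map_sub, E.proj_proj_self (measurableSet_singleton 0), sub_self]
      refine ⟨⟨_, hmem u hu⟩, ?_⟩
      change A u = A x
      rw [LinearPMap.map_sub, h', sub_zero]
  obtain ⟨K, hK⟩ := f.antilipschitz_of_injective_of_isClosed_range hfinj (by rwa [hrange])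
  -- The constant `K` may be `0`, hence `K + 1`.
  refine ⟨((K : ℝ) + 1)⁻¹, by positivity, fun x hx => ?_⟩
  have h1 : ‖(⟨_, hmem x hx⟩ : G)‖ ≤ K * ‖A x‖ := by
    exact hK.le_mul_norm (map_zero f) ⟨_, hmem x hx⟩
  have h2 : ‖(x : X)‖ ≤ ((K : ℝ) + 1) * ‖A x‖ := by
    have h3 : ‖(x : X)‖ ≤ ‖(⟨_, hmem x hx⟩ : G)‖ := norm_fst_le ((x : X), A x)
    nlinarith [norm_nonneg (A x)]
  rw [inv_mul_le_iff₀ (by positivity)]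
  exact h2

/-! ### The two implications via a punctured ball -/

/-- If `E` vanishes on a punctured ball around `0`, then `E({0})` and `E({|z| ≥ r})` are
complementary. -/
theorem proj_singleton_add {r : ℝ} (hr : 0 < r)
    (h : ∀ x, E.proj (Metric.ball 0 r \ {0}) x = 0) (x : X) :
    E.proj {0} x + E.proj (Metric.ball 0 r)ᶜ x = x := by
  have h1 := E.proj_add_compl (Metric.isOpen_ball (α := ℂ) (x := 0) (ε := r)).measurableSet x
  have h2 : Metric.ball (0 : ℂ) r = {0} ∪ Metric.ball 0 r \ {0} := by
    rw [Set.union_sdiff_cancel (by simpa using hr)]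
  have h3 := E.proj_union (measurableSet_singleton (0 : ℂ))
    ((Metric.isOpen_ball (α := ℂ) (x := 0) (ε := r)).measurableSet.diff
      (measurableSet_singleton 0)) Set.disjoint_sdiff_right x
  rw [← h2, h, add_zero] at h3
  rwa [h3] at h1

theorem isClosed_opRange_of_isolated [CompleteSpace X] (hA : IsSpectralOperator A E)
    (hker : ∀ x : X, ∃ h : E.proj {0} x ∈ A.domain, A ⟨E.proj {0} x, h⟩ = 0)
    {r : ℝ} (hr : 0 < r) (h : opSpectrum A ∩ Metric.ball 0 r = {0}) :
    IsClosed (opRange A) := by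
  -- Halving the radius keeps closures of subsets inside the open ball of radius `r`.
  have hE : ∀ x, E.proj (Metric.ball 0 (r / 2) \ {0}) x = 0 := fun x =>
    E.proj_diff_zero_eq_zero Metric.isOpen_ball.measurableSet fun δ hδ hsub h0 =>
      hA.proj_eq_zero_of_disjoint hδ (Metric.isBounded_ball.subset hsub)
        (Set.disjoint_left.2 fun z hz hzσ => by
          have h1 : z ∈ Metric.closedBall (0 : ℂ) (r / 2) :=
            closure_minimal (hsub.trans Metric.ball_subset_closedBall)
              Metric.isClosed_closedBall hz
          have h2 : z ∈ opSpectrum A ∩ Metric.ball 0 r :=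
            ⟨hzσ, Metric.closedBall_subset_ball (by linarith) h1⟩
          rw [h, Set.mem_singleton_iff] at h2
          exact h0 (h2 ▸ hz)) x
  have hrange : opRange A = {y | E.proj {0} y = 0} := by
    ext y
    constructor
    · rintro ⟨x, rfl⟩
      obtain ⟨h1, h2⟩ := hker x
      obtain ⟨h3, h4⟩ := hA.commute {0} (measurableSet_singleton 0) x
      exact h4.symm.trans h2
    · intro hy
      have h1 := proj_singleton_add (half_pos hr) hE y
      rw [show E.proj {0} y = 0 from hy, zero_add] at h1
      obtain ⟨x, -, hx⟩ := hA.exists_apply_sub_smul_eq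
        Metric.isOpen_ball.measurableSet.compl (z := 0)
        (by rw [Metric.isOpen_ball.isClosed_compl.closure_eq]; simpa using hr) h1
      exact ⟨x, by simpa using hx⟩
  rw [hrange]
  exact isClosed_eq (E.proj {0}).continuous continuous_const

/-- If `E` vanishes on a punctured ball around `0`, then this punctured ball is contained in the
resolvent set. -/
theorem notMem_opSpectrum_of_proj_eq_zero (hA : IsSpectralOperator A E)
    (hker : ∀ x : X, ∃ h : E.proj {0} x ∈ A.domain, A ⟨E.proj {0} x, h⟩ = 0)
    {r : ℝ} (hr : 0 < r) (hE : ∀ x, E.proj (Metric.ball 0 r \ {0}) x = 0) {z : ℂ}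
    (hz : z ∈ Metric.ball 0 r) (hz0 : z ≠ 0) : z ∉ opSpectrum A := by
  have hm : MeasurableSet (Metric.ball (0 : ℂ) r)ᶜ := Metric.isOpen_ball.measurableSet.compl
  have hzc : z ∉ closure (Metric.ball (0 : ℂ) r)ᶜ := by
    rw [Metric.isOpen_ball.isClosed_compl.closure_eq]
    exact fun h => h hz
  refine not_not.2 ⟨fun u v huv => ?_, fun y => ?_⟩
  · have hd : A (u - v) = z • ((u - v : A.domain) : X) := by
      rw [LinearPMap.map_sub, Submodule.coe_sub, smul_sub]
      have h1 : A u - z • (u : X) = A v - z • (v : X) := huv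
      rw [sub_eq_sub_iff_sub_eq_sub]
      exact h1
    obtain ⟨h1, h2⟩ := hker (u - v : A.domain)
    obtain ⟨h3, h4⟩ := hA.commute {0} (measurableSet_singleton 0) (u - v)
    have h5 : E.proj {0} ((u - v : A.domain) : X) = 0 := by
      have h6 : E.proj {0} (A (u - v)) = 0 := h4.symm.trans h2
      rw [hd, map_smul] at h6
      exact (smul_eq_zero.1 h6).resolve_left hz0
    have h7 := proj_singleton_add hr hE ((u - v : A.domain) : X)
    rw [h5, zero_add] at h7
    exact sub_eq_zero.1 (Subtype.ext (hA.eq_zero_of_apply_eq_smul hm hzc _ h7 hd))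
  · obtain ⟨x, -, hx⟩ := hA.exists_apply_sub_smul_eq hm hzc (E.proj_proj_self hm y)
    obtain ⟨h1, h2⟩ := hker y
    -- On `E({0})X` the operator `A - z` is `-z`, with inverse `-z⁻¹`.
    refine ⟨x - z⁻¹ • ⟨E.proj {0} y, h1⟩, ?_⟩
    have h3 := proj_singleton_add hr hE y
    change A (x - z⁻¹ • ⟨E.proj {0} y, h1⟩) - z • ((x : X) - z⁻¹ • E.proj {0} y) = y
    rw [LinearPMap.map_sub, LinearPMap.map_smul, h2, smul_zero, sub_zero, smul_sub,
      smul_inv_smul₀ hz0, sub_sub_eq_add_sub, add_sub_right_comm, hx, add_comm]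
    exact h3

theorem exists_isolated_of_isClosed_opRange [CompleteSpace X] (hA : IsSpectralOperator A E)
    (hker : ∀ x : X, ∃ h : E.proj {0} x ∈ A.domain, A ⟨E.proj {0} x, h⟩ = 0)
    (h0 : (0 : ℂ) ∈ opSpectrum A) (hcl : IsClosed (opRange A)) :
    ∃ r : ℝ, 0 < r ∧ opSpectrum A ∩ Metric.ball 0 r = {0} := by
  have hinj : ∀ x : A.domain, E.proj {0} (x : X) = 0 → A x = 0 → (x : X) = 0 := by
    intro x hx hAx
    -- For `0 ∉ closure δ`, the vector `E(δ)x` lies in the kernel of `A` on `E(δ)X`, where `A` is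
    -- injective.
    have h1 : E.proj (Set.univ \ {0}) (x : X) = 0 :=
      E.proj_diff_zero_eq_zero MeasurableSet.univ fun δ hδ _ hδ0 => by
        obtain ⟨h, h'⟩ := hA.commute δ hδ x
        exact hA.eq_zero_of_apply_eq_smul hδ hδ0 ⟨_, h⟩ (E.proj_proj_self hδ _)
          (by rw [h', hAx, map_zero, zero_smul])
    have h2 := E.proj_add_compl (measurableSet_singleton (0 : ℂ)) (x : X)
    rw [hx, Set.compl_eq_univ_sdiff, h1, add_zero] at h2
    exact h2.symm
  obtain ⟨c, hc, hbelow⟩ := hA.exists_bounded_below hker hinj hcl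
  have hm : MeasurableSet (Metric.ball (0 : ℂ) (c / 2) \ {0}) :=
    Metric.isOpen_ball.measurableSet.diff (measurableSet_singleton 0)
  have hE : ∀ x, E.proj (Metric.ball 0 (c / 2) \ {0}) x = 0 :=
    hA.proj_eq_zero_of_bounded_below hm (half_pos hc).le (half_lt_self hc)
      (Set.sdiff_subset.trans Metric.ball_subset_closedBall) fun x hx => hbelow x <| by
        rw [← hx, E.proj_apply_proj (measurableSet_singleton 0) hm, Set.inter_sdiff_self,
          E.proj_empty]
        rfl
  refine ⟨c / 2, half_pos hc, Set.Subset.antisymm ?_ ?_⟩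
  · rintro z ⟨hzσ, hz⟩
    by_contra hz0
    exact hA.notMem_opSpectrum_of_proj_eq_zero hker (half_pos hc) hE hz hz0 hzσ
  · rintro _ rfl
    exact ⟨h0, Metric.mem_ball_self (half_pos hc)⟩

end IsSpectralOperator

end ScalarSpectral

theorem theorem3p3 {X : Type*} [NormedAddCommGroup X] [NormedSpace ℂ X] [CompleteSpace X]
    (A : X →ₗ.[ℂ] X) (hA : ScalarSpectral.IsScalarType A)
    (h0 : (0 : ℂ) ∈ ScalarSpectral.opSpectrum A) :
    (∃ r : ℝ, 0 < r ∧ ScalarSpectral.opSpectrum A ∩ Metric.ball (0 : ℂ) r = {0}) ↔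
      IsClosed (ScalarSpectral.opRange A) := by
  obtain ⟨E, hAE, hint⟩ := hA
  have hker : ∀ x : X, ∃ h : E.proj {0} x ∈ A.domain, A ⟨E.proj {0} x, h⟩ = 0 := by
    rw [hint]
    exact E.spectralIntegral_proj_singleton rfl
  exact ⟨fun ⟨_, hr, h⟩ => hAE.isClosed_opRange_of_isolated hker hr h,
    hAE.exists_isolated_of_isClosed_opRange hker h0⟩
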